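/- Let $1\le s\le n$ and let $A\in\mathbb{R}^{s\times n}$ be a random matrix with independent standard Gaussian entries. Denote by $A_1,\dots,A_s\in\mathbb{R}^n$ the rows of $A$, let $\mathrm{vol}(A_1,\dots,A_{s-1})$ be the $(s-1)$-dimensional volume of the parallelepiped spanned by the first $s-1$ rows (equal to $1$ if $s=1$), and let $A_s^\perp$ be the orthogonal projection of $A_s$ onto the orthogonal complement of $\mathrm{span}(A_1,\dots,A_{s-1})$. Let $A^\dagger=A^T(AA^T)^{-1}$ be the Moore–Penrose inverse of $A$ (almost surely, $A$ has rank $s$), and let $Q_A\colon\mathbb{R}^s\to(\ker A)^\perp\subseteq\mathbb{R}^n$, $Q_A(u)=\sum_{\sigma=1}^s u_\sigma N_\sigma$, where $(N_1,\dots,N_s)$ is the orthonormal basis of $(\ker A)^\perp$ obtained from $A_1,\dots,A_s$ by Gram–Schmidt orthonormalization. Let $u$ be a random vector that is uniformly distributed on the unit sphere $S^{s-1}\subset\mathbb{R}^s$ and independent of $A$. Then the random variable $$\Big(\sqrt{\det AA^T},\ (A^\dagger)^T Q_A(u)\Big)$$ with values in $\mathbb{R}\times\mathbb{R}^s$ has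 the same distribution as $$\Big(\mathrm{vol}(A_1,\dots,A_{s-1})\cdot\|A_s^\perp\|,\ \frac1{\|A_s^\perp\|}\,w\Big),$$ where $w$ is uniformly distributed on $S^{s-1}$ and independent of $A$. -/

import Mathlib

open MeasureTheory ProbabilityTheory
open scoped Matrix

noncomputable section

/-- The `i`-th row of a real matrix, as a vector of Euclidean space. -/
def rowVec {s n : ℕ} (A : Matrix (Fin s) (Fin n) ℝ) (i : Fin s) : EuclideanSpace ℝ (Fin n) :=
  WithLp.toLp 2 (A i)

/-- The orthogonal component `A_m^⊥` of the row `A_m`: the orthogonal projection of `A_m` onto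
the orthogonal complement of the span of the preceding rows. -/
def rowPerp {s n : ℕ} (A : Matrix (Fin s) (Fin n) ℝ) (m : Fin s) : EuclideanSpace ℝ (Fin n) :=
  (Submodule.span ℝ (rowVec A '' {i | i < m}))ᗮ.starProjection (rowVec A m)

/-- The `m`-dimensional volume of the parallelepiped spanned by `m` vectors of `ℝⁿ`
(`m`-dimensional Hausdorff measure, normalised to agree with Lebesgue measure on `ℝᵐ`).
For `m = 0` it is `1`. -/
def parallelepipedVol {m n : ℕ} (v : Fin m → EuclideanSpace ℝ (Fin n)) : ℝ :=
  (μHE[m] (parallelepiped v)).toReal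

/-- `vol(A_1, …, A_m)`: the volume spanned by the first `m` rows of `A`. -/
def rowVol {s n : ℕ} (A : Matrix (Fin s) (Fin n) ℝ) (m : ℕ) (hm : m ≤ s) : ℝ :=
  parallelepipedVol fun i : Fin m => rowVec A (Fin.castLE hm i)

/-- The Moore-Penrose inverse `Aᵀ (A Aᵀ)⁻¹` of an `s × n` matrix `A` of rank `s`. -/
def moorePenrose {s n : ℕ} (A : Matrix (Fin s) (Fin n) ℝ) : Matrix (Fin n) (Fin s) ℝ :=
  Aᵀ * (A * Aᵀ)⁻¹

/-- The map `Q_A : u ↦ ∑ σ, u_σ N_σ`, where `N_1, …, N_s` is obtained from the rows of `A` by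
Gram-Schmidt orthonormalization. -/
def gramSchmidtMap {s n : ℕ} (A : Matrix (Fin s) (Fin n) ℝ) (u : EuclideanSpace ℝ (Fin s)) :
    EuclideanSpace ℝ (Fin n) :=
  ∑ σ : Fin s, u σ • InnerProductSpace.gramSchmidtNormed ℝ (rowVec A) σ

/-- The endomorphism `(A^†)ᵀ Q_A` of `ℝˢ`. -/
def daggerQ {s n : ℕ} (A : Matrix (Fin s) (Fin n) ℝ) (u : EuclideanSpace ℝ (Fin s)) :
    EuclideanSpace ℝ (Fin s) :=
  WithLp.toLp 2 ((moorePenrose A)ᵀ *ᵥ (gramSchmidtMap A u).ofLp)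

/-- The uniform distribution on the unit sphere `S^{s-1}` of `ℝˢ`: the normalised surface
measure (a probability measure for `s ≥ 1`). -/
def uniformSphere (s : ℕ) : Measure (Metric.sphere (0 : EuclideanSpace ℝ (Fin s)) 1) :=
  ((volume : Measure (EuclideanSpace ℝ (Fin s))).toSphere Set.univ)⁻¹ •
    (volume : Measure (EuclideanSpace ℝ (Fin s))).toSphere

end

/-! Write `D` for `daggerMatrix A`, the matrix of `(A^†)ᵀ Q_A`. When `A` has full rank, `D Dᵀ = (A
Aᵀ)⁻¹`. Two matrices with the same invertible `D Dᵀ` differ by an orthogonal factor on the right,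
which a uniform `u` absorbs, so for fixed `A` the law of `D u` depends only on `(A Aᵀ)⁻¹`.

For orthogonal `M`, `M A` is distributed as `A`, has the same determinant `det A Aᵀ`, and turns `(A
Aᵀ)⁻¹` into `M (A Aᵀ)⁻¹ Mᵀ`. Hence the joint law of `(√det A Aᵀ, D u)` is invariant under rotation
of its second component, and averaging over the orthogonal group
(`lintegral_eq_lintegral_norm_smul`) replaces `D u` by `‖D u‖ w` with a fresh uniform `w`.

Given `A`, `‖D u‖²` has the law of the quadratic form `⟨u, (A Aᵀ)⁻¹ u⟩`. For fixed `u`, a rotation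
of `A` moves `u` to the last basis vector, leaving the last diagonal entry of `(A Aᵀ)⁻¹`. This entry
equals `1 / ‖A_s^⊥‖²`, and the cofactor formula for it gives the volume factorization of `√det A Aᵀ`
(`lintegral_daggerMatrix_eq` and the two `rowPerp` identities). -/

/-- The action of a square matrix on Euclidean space. -/
noncomputable def matAct {s : ℕ} (M : Matrix (Fin s) (Fin s) ℝ) (x : EuclideanSpace ℝ (Fin s)) :
    EuclideanSpace ℝ (Fin s) :=
  WithLp.toLp 2 (M *ᵥ x.ofLp)

theorem matAct_mul {s : ℕ} (M N : Matrix (Fin s) (Fin s) ℝ) (x : EuclideanSpace ℝ (Fin s)) :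
    matAct (M * N) x = matAct M (matAct N x) := by
  simp [matAct, Matrix.mulVec_mulVec]

theorem matAct_one {s : ℕ} (x : EuclideanSpace ℝ (Fin s)) : matAct 1 x = x := by
  simp [matAct]

theorem matAct_smul {s : ℕ} (M : Matrix (Fin s) (Fin s) ℝ) (c : ℝ)
    (x : EuclideanSpace ℝ (Fin s)) : matAct M (c • x) = c • matAct M x := by
  simp [matAct, Matrix.mulVec_smul]

theorem inner_matAct {s : ℕ} (M : Matrix (Fin s) (Fin s) ℝ) (x y : EuclideanSpace ℝ (Fin s)) :
    inner ℝ (matAct M x) y = inner ℝ x (matAct Mᵀ y) := by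
  simp only [matAct, EuclideanSpace.inner_eq_star_dotProduct, star_trivial]
  rw [Matrix.dotProduct_mulVec, Matrix.mulVec_transpose]

theorem continuous_matAct {s : ℕ} (M : Matrix (Fin s) (Fin s) ℝ) : Continuous (matAct M) := by
  unfold matAct
  exact (PiLp.continuous_toLp 2 _).comp
    (Continuous.matrix_mulVec continuous_const (PiLp.continuous_ofLp 2 _))

theorem norm_matAct {s : ℕ} {M : Matrix (Fin s) (Fin s) ℝ} (hM : Mᵀ * M = 1)
    (x : EuclideanSpace ℝ (Fin s)) : ‖matAct M x‖ = ‖x‖ := by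
  rw [← sq_eq_sq₀ (norm_nonneg _) (norm_nonneg _), ← real_inner_self_eq_norm_sq,
    ← real_inner_self_eq_norm_sq, inner_matAct, ← matAct_mul, hM, matAct_one]

/-- The linear isometry of Euclidean space defined by an orthogonal matrix. -/
noncomputable def matActIso {s : ℕ} (M : Matrix (Fin s) (Fin s) ℝ) (hM : Mᵀ * M = 1) :
    EuclideanSpace ℝ (Fin s) ≃ₗᵢ[ℝ] EuclideanSpace ℝ (Fin s) where
  toFun := matAct M
  invFun := matAct Mᵀ
  left_inv x := by rw [← matAct_mul, hM, matAct_one]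
  right_inv x := by rw [← matAct_mul, mul_eq_one_comm.mp hM, matAct_one]
  map_add' x y := by simp [matAct, Matrix.mulVec_add]
  map_smul' c x := matAct_smul M c x
  norm_map' x := norm_matAct hM x

/-! ### Rotation invariance of the uniform law on the sphere -/

/-- The uniform distribution on the unit sphere, as a measure on Euclidean space. -/
noncomputable def sphereLaw (s : ℕ) : Measure (EuclideanSpace ℝ (Fin s)) :=
  (uniformSphere s).map (↑)

theorem isProbabilityMeasure_uniformSphere {s : ℕ} (hs : 1 ≤ s) :
    IsProbabilityMeasure (uniformSphere s) := by
  have : Nonempty (Fin s) := ⟨⟨0, hs⟩⟩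
  constructor
  rw [uniformSphere, Measure.smul_apply, smul_eq_mul]
  refine ENNReal.inv_mul_cancel ?_ (measure_ne_top _ _)
  rw [Ne, Measure.measure_univ_eq_zero]
  exact Measure.toSphere_ne_zero _

theorem isProbabilityMeasure_sphereLaw {s : ℕ} (hs : 1 ≤ s) :
    IsProbabilityMeasure (sphereLaw s) := by
  have := isProbabilityMeasure_uniformSphere hs
  exact Measure.isProbabilityMeasure_map measurable_subtype_coe.aemeasurable

theorem ae_norm_eq_one_sphereLaw (s : ℕ) : ∀ᵐ x ∂sphereLaw s, ‖x‖ = 1 := by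
  rw [sphereLaw, ae_map_iff measurable_subtype_coe.aemeasurable
    (measurableSet_eq_fun measurable_norm measurable_const)]
  exact Filter.Eventually.of_forall fun x => by simp

theorem sphereLaw_apply {s : ℕ} {S : Set (EuclideanSpace ℝ (Fin s))} (hS : MeasurableSet S) :
    sphereLaw s S = ((volume : Measure (EuclideanSpace ℝ (Fin s))).toSphere Set.univ)⁻¹ *
      (Module.finrank ℝ (EuclideanSpace ℝ (Fin s)) *
        volume {x | ∃ r ∈ Set.Ioo (0 : ℝ) 1, ∃ y ∈ S, ‖y‖ = 1 ∧ r • y = x}) := by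
  rw [sphereLaw, Measure.map_apply measurable_subtype_coe hS, uniformSphere, Measure.smul_apply,
    smul_eq_mul, Measure.toSphere_apply' _ (measurable_subtype_coe hS)]
  congr 3
  ext x
  simp only [Set.mem_smul, Set.mem_image, Set.mem_preimage, Subtype.exists, Set.mem_ofPred_eq,
    mem_sphere_zero_iff_norm]
  grind

/-- The mass of `S` is proportional to the volume of the cone over `S`; orthogonal maps carry cones
to cones and preserve volume. -/
theorem map_matAct_sphereLaw {s : ℕ} {M : Matrix (Fin s) (Fin s) ℝ} (hM : Mᵀ * M = 1) :
    (sphereLaw s).map (matAct M) = sphereLaw s := by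
  ext S hS
  rw [Measure.map_apply (continuous_matAct M).measurable hS, sphereLaw_apply hS,
    sphereLaw_apply ((continuous_matAct M).measurable hS)]
  congr 2
  conv_rhs => rw [← (matActIso M hM).measurePreserving.measure_preimage_emb
    (matActIso M hM).toHomeomorph.measurableEmbedding]
  congr 1
  ext x
  change (∃ r ∈ Set.Ioo (0 : ℝ) 1, ∃ y, matAct M y ∈ S ∧ ‖y‖ = 1 ∧ r • y = x) ↔
    ∃ r ∈ Set.Ioo (0 : ℝ) 1, ∃ y ∈ S, ‖y‖ = 1 ∧ r • y = matAct M x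
  constructor
  · rintro ⟨r, hr, y, hy, hy1, rfl⟩
    exact ⟨r, hr, _, hy, by rw [norm_matAct hM, hy1], (matAct_smul _ _ _).symm⟩
  · rintro ⟨r, hr, y, hy, hy1, h⟩
    refine ⟨r, hr, matAct Mᵀ y, ?_, ?_, ?_⟩
    · rwa [← matAct_mul, mul_eq_one_comm.mp hM, matAct_one]
    · rw [norm_matAct (by simpa using mul_eq_one_comm.mp hM), hy1]
    · rw [← matAct_smul, h, ← matAct_mul, hM, matAct_one]

theorem lintegral_matAct_sphereLaw {s : ℕ} {M : Matrix (Fin s) (Fin s) ℝ} (hM : Mᵀ * M = 1)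
    {g : EuclideanSpace ℝ (Fin s) → ENNReal} (hg : Measurable g) :
    ∫⁻ x, g (matAct M x) ∂sphereLaw s = ∫⁻ x, g x ∂sphereLaw s := by
  conv_rhs => rw [← map_matAct_sphereLaw hM]
  rw [lintegral_map hg (continuous_matAct M).measurable]

/-- `R⁻¹ T` is orthogonal, so `T` is `R` after a rotation that the uniform law does not see. -/
theorem lintegral_matAct_sphereLaw_congr {s : ℕ} {R T : Matrix (Fin s) (Fin s) ℝ}
    (hR : R.det ≠ 0) (h : T * Tᵀ = R * Rᵀ)
    {g : EuclideanSpace ℝ (Fin s) → ENNReal} (hg : Measurable g) :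
    ∫⁻ x, g (matAct T x) ∂sphereLaw s = ∫⁻ x, g (matAct R x) ∂sphereLaw s := by
  have hu : IsUnit R.det := isUnit_iff_ne_zero.mpr hR
  have hut : IsUnit Rᵀ.det := by rwa [Matrix.det_transpose]
  have hK : (R⁻¹ * T)ᵀ * (R⁻¹ * T) = 1 := by
    rw [mul_eq_one_comm, Matrix.transpose_mul, Matrix.transpose_nonsing_inv, mul_assoc,
      ← mul_assoc T, h, mul_assoc R, Matrix.mul_nonsing_inv _ hut, mul_one,
      Matrix.nonsing_inv_mul _ hu]
  rw [← lintegral_matAct_sphereLaw hK (g := fun x => g (matAct R x))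
    (hg.comp (continuous_matAct R).measurable)]
  simp only [← matAct_mul, ← mul_assoc, Matrix.mul_nonsing_inv _ hu, one_mul]

/-! ### Averaging over the orthogonal group -/

theorem exists_orthogonal_matAct_eq {s : ℕ} {x y : EuclideanSpace ℝ (Fin s)} (h : ‖x‖ = ‖y‖) :
    ∃ M : Matrix (Fin s) (Fin s) ℝ, Mᵀ * M = 1 ∧ matAct M x = y := by
  let e := (ℝ ∙ (x - y))ᗮ.reflection
  let b := EuclideanSpace.basisFun (Fin s) ℝ
  refine ⟨e.toLinearMap.toMatrix b.toBasis b.toBasis, ?_, ?_⟩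
  · exact (Matrix.mem_orthogonalGroup_iff' (Fin s) ℝ).mp (e.toMatrix_mem_unitaryGroup b b)
  · have h1 := LinearMap.toMatrix_mulVec_repr b.toBasis b.toBasis e.toLinearMap x
    ext i
    have h2 := congrFun h1 i
    have h3 : e x = y := Submodule.reflection_sub h
    rw [← h3]
    exact h2

instance compactSpace_orthogonalGroup (s : ℕ) :
    CompactSpace (Matrix.orthogonalGroup (Fin s) ℝ) := by
  refine isCompact_iff_compactSpace.mp
    (?_ : IsCompact (Matrix.orthogonalGroup (Fin s) ℝ : Set (Matrix (Fin s) (Fin s) ℝ)))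
  have h1 : IsCompact (Set.univ.pi fun _ : Fin s => Set.univ.pi fun _ : Fin s =>
    Set.Icc (-1 : ℝ) 1) := isCompact_univ_pi fun _ => isCompact_univ_pi fun _ => isCompact_Icc
  refine IsCompact.of_isClosed_subset (X := Matrix (Fin s) (Fin s) ℝ) h1 isClosed_unitary ?_
  intro U hU i _ j _
  have := entry_norm_bound_of_unitary (𝕜 := ℝ) hU i j
  rwa [Real.norm_eq_abs, abs_le] at this

/-- The Haar average `F` of `f` over rotations of the second variable is radial in it. Invariance of
`ν` replaces `f` by `F`, radiality lets the vector be moved to any point of its sphere, and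
invariance of the uniform law undoes the average. -/
theorem lintegral_eq_lintegral_norm_smul {s : ℕ} {T : Type*} [MeasurableSpace T]
    (ν : Measure (T × EuclideanSpace ℝ (Fin s))) [SFinite ν] (hs : 1 ≤ s)
    (hν : ∀ M : Matrix (Fin s) (Fin s) ℝ, Mᵀ * M = 1 →
      ∀ f : T × EuclideanSpace ℝ (Fin s) → ENNReal,
      Measurable f → ∫⁻ p, f (p.1, matAct M p.2) ∂ν = ∫⁻ p, f p ∂ν)
    {f : T × EuclideanSpace ℝ (Fin s) → ENNReal} (hf : Measurable f) :
    ∫⁻ p, f p ∂ν = ∫⁻ p, ∫⁻ w, f (p.1, ‖p.2‖ • w) ∂sphereLaw s ∂ν := by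
  have := isProbabilityMeasure_sphereLaw hs
  let K := Matrix.orthogonalGroup (Fin s) ℝ
  let _ : MeasurableSpace K := borel K
  have : BorelSpace K := ⟨rfl⟩
  have : SecondCountableTopology (Matrix (Fin s) (Fin s) ℝ) :=
    inferInstanceAs (SecondCountableTopology (Fin s → Fin s → ℝ))
  obtain ⟨κ, hκ1, hκ2⟩ : ∃ κ : Measure K, IsProbabilityMeasure κ ∧ κ.IsMulLeftInvariant :=
    ⟨Measure.haarMeasure ⊤, ⟨by
      simpa using Measure.haarMeasure_self (K₀ := (⊤ : TopologicalSpace.PositiveCompacts K))⟩,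
      inferInstance⟩
  -- Acting through `O⁻¹` makes left invariance of Haar measure enough to absorb a rotation `U` of
  -- the vector.
  have hκ3 : ∀ (φ : K → ENNReal) (U : K), ∫⁻ O, φ (U⁻¹ * O)⁻¹ ∂κ = ∫⁻ O, φ O⁻¹ ∂κ := fun φ U =>
    lintegral_mul_left_eq_self (fun O => φ O⁻¹) U⁻¹
  have hO : ∀ O : K, (O : Matrix (Fin s) (Fin s) ℝ)ᵀ * O = 1 := fun O =>
    (Matrix.mem_orthogonalGroup_iff' (Fin s) ℝ).mp O.2
  have hact : Continuous fun q : K × EuclideanSpace ℝ (Fin s) =>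
      matAct ((q.1⁻¹ : K) : Matrix (Fin s) (Fin s) ℝ) q.2 := by
    refine (PiLp.continuous_toLp 2 _).comp (Continuous.matrix_mulVec ?_ ?_)
    · exact continuous_subtype_val.comp (continuous_inv.comp continuous_fst)
    · exact (PiLp.continuous_ofLp 2 _).comp continuous_snd
  let F : T → EuclideanSpace ℝ (Fin s) → ENNReal := fun t x =>
    ∫⁻ O, f (t, matAct ((O⁻¹ : K) : Matrix (Fin s) (Fin s) ℝ) x) ∂κ
  have hm : Measurable fun q : (T × EuclideanSpace ℝ (Fin s)) × K =>
      f (q.1.1, matAct ((q.2⁻¹ : K) : Matrix (Fin s) (Fin s) ℝ) q.1.2) := by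
    have h1 : Measurable fun q : (T × EuclideanSpace ℝ (Fin s)) × K => (q.2, q.1.2) := by fun_prop
    have h2 : Measurable fun q : (T × EuclideanSpace ℝ (Fin s)) × K => q.1.1 := by fun_prop
    have h3 := hact.measurable.comp h1
    exact hf.comp (h2.prodMk h3)
  have hFinv : ∀ (U : K) t x, F t (matAct (U : Matrix (Fin s) (Fin s) ℝ) x) = F t x := by
    intro U t x
    have h2 : ∀ O : K, f (t, matAct ((O⁻¹ : K) : Matrix (Fin s) (Fin s) ℝ)
        (matAct (U : Matrix (Fin s) (Fin s) ℝ) x)) =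
        f (t, matAct (((U⁻¹ * O)⁻¹ : K) : Matrix (Fin s) (Fin s) ℝ) x) := by
      intro O
      rw [← matAct_mul, mul_inv_rev, inv_inv, Submonoid.coe_mul]
    exact (lintegral_congr h2).trans
      (hκ3 (fun V => f (t, matAct (V : Matrix (Fin s) (Fin s) ℝ) x)) U)
  have hFnorm : ∀ t (x y : EuclideanSpace ℝ (Fin s)), ‖x‖ = ‖y‖ → F t x = F t y := by
    intro t x y hxy
    obtain ⟨M, hM, rfl⟩ := exists_orthogonal_matAct_eq hxy
    exact (hFinv ⟨M, (Matrix.mem_orthogonalGroup_iff' (Fin s) ℝ).mpr hM⟩ t x).symm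
  calc ∫⁻ p, f p ∂ν
      = ∫⁻ O, ∫⁻ p, f (p.1, matAct ((O⁻¹ : K) : Matrix (Fin s) (Fin s) ℝ) p.2) ∂ν ∂κ := by
        simp [fun O : K => hν _ (hO O⁻¹) f hf]
    _ = ∫⁻ p, F p.1 p.2 ∂ν := by
        rw [lintegral_lintegral_swap]
        exact (hm.comp measurable_swap).aemeasurable
    _ = ∫⁻ p, ∫⁻ w, F p.1 (‖p.2‖ • w) ∂sphereLaw s ∂ν := by
        refine lintegral_congr fun p => ?_
        have : ∀ᵐ w ∂sphereLaw s, F p.1 (‖p.2‖ • w) = F p.1 p.2 := by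
          filter_upwards [ae_norm_eq_one_sphereLaw s] with w hw
          exact hFnorm _ _ _ (by simp [norm_smul, hw])
        rw [lintegral_congr_ae this]
        simp
    _ = ∫⁻ p, ∫⁻ w, f (p.1, ‖p.2‖ • w) ∂sphereLaw s ∂ν := by
        refine lintegral_congr fun p => ?_
        simp only [F]
        rw [lintegral_lintegral_swap]
        · have : ∀ O : K, ∫⁻ w, f (p.1, matAct ((O⁻¹ : K) : Matrix (Fin s) (Fin s) ℝ) (‖p.2‖ • w))
              ∂sphereLaw s = ∫⁻ w, f (p.1, ‖p.2‖ • w) ∂sphereLaw s := by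
            intro O
            simp only [matAct_smul]
            exact lintegral_matAct_sphereLaw (hO O⁻¹) (g := fun w => f (p.1, ‖p.2‖ • w))
              (by fun_prop)
          simp [this]
        · have h : Measurable fun q : EuclideanSpace ℝ (Fin s) × K =>
              ((p.1, ‖p.2‖ • q.1), q.2) := by fun_prop
          exact (hm.comp h).aemeasurable

/-! ### The matrix of the dagger map and its Gram matrix -/

/-- The matrix whose rows are the Gram-Schmidt orthonormalization of the rows of `A`. -/
noncomputable def gramSchmidtMatrix {s n : ℕ} (A : Matrix (Fin s) (Fin n) ℝ) :
    Matrix (Fin s) (Fin n) ℝ :=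
  Matrix.of fun i j => InnerProductSpace.gramSchmidtNormed ℝ (rowVec A) i j

/-- The matrix of `daggerQ A`. -/
noncomputable def daggerMatrix {s n : ℕ} (A : Matrix (Fin s) (Fin n) ℝ) :
    Matrix (Fin s) (Fin s) ℝ :=
  (moorePenrose A)ᵀ * (gramSchmidtMatrix A)ᵀ

theorem daggerQ_eq_matAct {s n : ℕ} (A : Matrix (Fin s) (Fin n) ℝ)
    (u : EuclideanSpace ℝ (Fin s)) : daggerQ A u = matAct (daggerMatrix A) u := by
  have h : (gramSchmidtMap A u).ofLp = (gramSchmidtMatrix A)ᵀ *ᵥ u.ofLp := by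
    ext j
    simp [gramSchmidtMap, gramSchmidtMatrix, Matrix.mulVec, dotProduct, mul_comm]
  rw [daggerQ, matAct, h, daggerMatrix, Matrix.mulVec_mulVec]

theorem gram_rowVec {s n : ℕ} (A : Matrix (Fin s) (Fin n) ℝ) :
    Matrix.gram ℝ (rowVec A) = A * Aᵀ := by
  ext i j
  simp [Matrix.gram_apply, rowVec, EuclideanSpace.inner_eq_star_dotProduct, Matrix.mul_apply,
    dotProduct, mul_comm]

theorem linearIndependent_rowVec {s n : ℕ} {A : Matrix (Fin s) (Fin n) ℝ}
    (hA : (A * Aᵀ).det ≠ 0) : LinearIndependent ℝ (rowVec A) :=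
  Matrix.linearIndependent_of_det_gram_ne_zero (by rwa [gram_rowVec])

/-- `NᵀN` is the projection onto the span of the rows of `A`, so it fixes them. -/
theorem gramSchmidtMatrix_transpose_mul_mul_transpose {s n : ℕ} {A : Matrix (Fin s) (Fin n) ℝ}
    (hA : (A * Aᵀ).det ≠ 0) :
    (gramSchmidtMatrix A)ᵀ * gramSchmidtMatrix A * Aᵀ = Aᵀ := by
  have hli := linearIndependent_rowVec hA
  have ho := InnerProductSpace.gramSchmidtNormed_orthonormal hli
  ext j i
  have hmem : rowVec A i ∈
      Submodule.span ℝ (Set.range (InnerProductSpace.gramSchmidtNormed ℝ (rowVec A))) := by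
    rw [InnerProductSpace.span_gramSchmidtNormed_range, InnerProductSpace.span_gramSchmidt]
    exact Submodule.subset_span ⟨i, rfl⟩
  obtain ⟨c, hc⟩ := (Submodule.mem_span_range_iff_exists_fun ℝ).mp hmem
  have h1 : ∀ k, (gramSchmidtMatrix A * Aᵀ) k i = c k := by
    intro k
    have h2 := ho.inner_right_fintype c k
    rw [hc] at h2
    rw [← h2]
    simp [gramSchmidtMatrix, rowVec, EuclideanSpace.inner_eq_star_dotProduct, Matrix.mul_apply,
      dotProduct, mul_comm]
  have h3 := congrArg (fun v : EuclideanSpace ℝ (Fin n) => v j) hc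
  rw [Matrix.mul_assoc, Matrix.mul_apply]
  simp only [h1]
  simpa [gramSchmidtMatrix, rowVec, mul_comm] using h3

theorem daggerMatrix_mul_transpose {s n : ℕ} {A : Matrix (Fin s) (Fin n) ℝ}
    (hA : (A * Aᵀ).det ≠ 0) : daggerMatrix A * (daggerMatrix A)ᵀ = (A * Aᵀ)⁻¹ := by
  have h1 : (moorePenrose A)ᵀ = (A * Aᵀ)⁻¹ * A := by
    simp [moorePenrose, Matrix.transpose_mul, Matrix.transpose_nonsing_inv]
  have h2 := gramSchmidtMatrix_transpose_mul_mul_transpose hA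
  have hu : IsUnit (A * Aᵀ).det := isUnit_iff_ne_zero.mpr hA
  calc daggerMatrix A * (daggerMatrix A)ᵀ
      = (A * Aᵀ)⁻¹ * A * ((gramSchmidtMatrix A)ᵀ * gramSchmidtMatrix A * Aᵀ) * (A * Aᵀ)⁻¹ := by
        rw [daggerMatrix, h1]
        simp only [Matrix.transpose_mul, Matrix.transpose_nonsing_inv, Matrix.transpose_transpose,
          Matrix.mul_assoc]
    _ = (A * Aᵀ)⁻¹ := by
        rw [h2, Matrix.mul_assoc (A * Aᵀ)⁻¹ A, Matrix.nonsing_inv_mul _ hu, Matrix.one_mul]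

theorem det_daggerMatrix_ne_zero {s n : ℕ} {A : Matrix (Fin s) (Fin n) ℝ}
    (hA : (A * Aᵀ).det ≠ 0) : (daggerMatrix A).det ≠ 0 := by
  intro h
  have h1 := congrArg Matrix.det (daggerMatrix_mul_transpose hA)
  rw [Matrix.det_mul, h, zero_mul, Matrix.det_nonsing_inv, Ring.inverse_eq_inv'] at h1
  exact inv_ne_zero hA h1.symm

/-! ### Volumes and the last row -/

/-- The parallelepiped is the image of the unit cube under a linear map, whose volume distortion
squared is the Gram determinant. -/
theorem parallelepipedVol_eq_sqrt_det_gram {m n : ℕ} (v : Fin m → EuclideanSpace ℝ (Fin n)) :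
    parallelepipedVol v = √(Matrix.gram ℝ v).det := by
  let b := EuclideanSpace.basisFun (Fin m) ℝ
  let f : EuclideanSpace ℝ (Fin m) →ₗ[ℝ] EuclideanSpace ℝ (Fin n) := b.toBasis.constr ℝ v
  have hf : ∀ i, f (b i) = v i := fun i => by
    have := b.toBasis.constr_basis ℝ v i
    rwa [b.coe_toBasis] at this
  have h1 : parallelepiped v = f '' parallelepiped b := by
    rw [image_parallelepiped f b, show f ∘ b = v from funext hf]
  have h2 := f.euclideanHausdorffMeasure_image_eq_normDet_mul_volume (parallelepiped b)
  rw [finrank_euclideanSpace_fin, b.volume_parallelepiped, mul_one] at h2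
  have h3 := f.normDet_sq_eq_det_gram b
  simp only [hf] at h3
  rw [parallelepipedVol, h1, h2, ENNReal.toReal_ofReal f.normDet_nonneg]
  rw [show (Matrix.gram ℝ v).det = f.normDet ^ 2 from h3.symm, Real.sqrt_sq f.normDet_nonneg]

/-- The last column of `(A Aᵀ)⁻¹` gives the coefficients of the dual vector `z` in the row span,
orthogonal to all rows but the last, with which it pairs to `1`. Projecting `z` shows that it is a
multiple of `A_s^⊥`, and the pairing fixes the factor. -/
theorem inv_mul_norm_rowPerp_sq {k n : ℕ} {A : Matrix (Fin (k + 1)) (Fin n) ℝ}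
    (hA : (A * Aᵀ).det ≠ 0) :
    (A * Aᵀ)⁻¹ (Fin.last k) (Fin.last k) * ‖rowPerp A (Fin.last k)‖ ^ 2 = 1 := by
  have hu : IsUnit (A * Aᵀ).det := isUnit_iff_ne_zero.mpr hA
  set W := Submodule.span ℝ (rowVec A '' {i | i < Fin.last k}) with hW
  set y : Fin (k + 1) → ℝ := fun i => (A * Aᵀ)⁻¹ i (Fin.last k) with hy
  set z : EuclideanSpace ℝ (Fin n) := ∑ i, y i • rowVec A i with hz
  have h1 : ∀ i, inner ℝ (rowVec A i) z = if i = Fin.last k then 1 else 0 := by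
    intro i
    have h := congrFun (congrFun (Matrix.mul_nonsing_inv _ hu) i) (Fin.last k)
    rw [Matrix.mul_apply, Matrix.one_apply] at h
    rw [← h, hz, inner_sum]
    refine Finset.sum_congr rfl fun j _ => ?_
    rw [inner_smul_right, ← Matrix.gram_apply, gram_rowVec, mul_comm]
  have hzW : z ∈ Wᗮ := by
    rw [Submodule.mem_orthogonal]
    intro w hw
    induction hw using Submodule.span_induction with
    | mem x hx =>
      obtain ⟨i, hi, rfl⟩ := hx
      rw [h1, if_neg (ne_of_lt hi)]
    | zero => exact inner_zero_left _
    | add x x' _ _ hx hx' => rw [inner_add_left, hx, hx', add_zero]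
    | smul c x _ hx => rw [inner_smul_left, hx, mul_zero]
  have hproj : z = y (Fin.last k) • rowPerp A (Fin.last k) := by
    have h2 : Wᗮ.starProjection z = z := Submodule.starProjection_eq_self_iff.mpr hzW
    rw [← h2, hz, map_sum, Finset.sum_eq_single (Fin.last k)]
    · rw [map_smul]
      rfl
    · intro i _ hi
      have h3 : rowVec A i ∈ Wᗮᗮ := by
        rw [Submodule.orthogonal_orthogonal]
        exact Submodule.subset_span ⟨i, Fin.lt_last_iff_ne_last.mpr hi, rfl⟩
      rw [map_smul, (Submodule.starProjection_apply_eq_zero_iff _).mpr h3, smul_zero]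
    · simp
  have h4 := h1 (Fin.last k)
  rw [if_pos rfl, hproj, inner_smul_right] at h4
  rw [← h4]
  congr 1
  rw [← real_inner_self_eq_norm_sq]
  simp only [rowPerp, Submodule.inner_starProjection_left_eq_right]
  rw [← ContinuousLinearMap.comp_apply, ← ContinuousLinearMap.mul_def,
    (Submodule.isIdempotentElem_starProjection _).eq]

theorem sqrt_inv_eq_inv_norm_rowPerp {k n : ℕ} {A : Matrix (Fin (k + 1)) (Fin n) ℝ}
    (hA : (A * Aᵀ).det ≠ 0) :
    √((A * Aᵀ)⁻¹ (Fin.last k) (Fin.last k)) = 1 / ‖rowPerp A (Fin.last k)‖ := by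
  rw [eq_one_div_of_mul_eq_one_left (inv_mul_norm_rowPerp_sq hA), Real.sqrt_div zero_le_one,
    Real.sqrt_one, Real.sqrt_sq (norm_nonneg _)]

/-- By Cramer's rule the last diagonal entry of the inverse is the Gram determinant of the earlier
rows over the full one. -/
theorem sqrt_det_eq_rowVol_mul_norm_rowPerp {k n : ℕ} {A : Matrix (Fin (k + 1)) (Fin n) ℝ}
    (hA : (A * Aᵀ).det ≠ 0) :
    √(A * Aᵀ).det = rowVol A k (Nat.le_succ k) * ‖rowPerp A (Fin.last k)‖ := by
  have h1 : (A * Aᵀ)⁻¹ (Fin.last k) (Fin.last k) = (A * Aᵀ).det⁻¹ *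
      (Matrix.gram ℝ fun i : Fin k => rowVec A (Fin.castLE (Nat.le_succ k) i)).det := by
    rw [Matrix.inv_def, Matrix.smul_apply, Ring.inverse_eq_inv', smul_eq_mul,
      Matrix.adjugate_fin_succ_eq_det_submatrix, ← gram_rowVec]
    congr 1
    rw [← two_mul, pow_mul]
    simp only [even_two, Even.neg_pow, one_pow, one_mul, Fin.succAbove_last]
    rfl
  have h2 := inv_mul_norm_rowPerp_sq hA
  rw [h1, mul_assoc, inv_mul_eq_iff_eq_mul₀ hA, mul_one] at h2
  rw [rowVol, parallelepipedVol_eq_sqrt_det_gram, ← h2, Real.sqrt_mul',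
    Real.sqrt_sq (norm_nonneg _)]
  positivity

/-- A positive definite matrix has an invertible symmetric square root. -/
theorem exists_symmetric_mul_self_eq {s : ℕ} {G : Matrix (Fin s) (Fin s) ℝ} (hG : G.PosDef) :
    ∃ R : Matrix (Fin s) (Fin s) ℝ, Rᵀ = R ∧ R * R = G ∧ R.det ≠ 0 := by
  open scoped MatrixOrder Matrix.Norms.L2Operator in
  have h1 : CFC.sqrt G * CFC.sqrt G = G := CFC.sqrt_mul_sqrt_self G hG.posSemidef.nonneg
  refine ⟨CFC.sqrt G, ?_, h1, fun h => hG.det_pos.ne' ?_⟩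
  · have h2 := (Matrix.nonneg_iff_posSemidef.mp (CFC.sqrt_nonneg G)).isHermitian
    rwa [Matrix.IsHermitian, Matrix.conjTranspose_eq_transpose_of_trivial] at h2
  · rw [← h1, Matrix.det_mul, h, zero_mul]

theorem posDef_inv_mul_transpose {s n : ℕ} {A : Matrix (Fin s) (Fin n) ℝ}
    (hA : (A * Aᵀ).det ≠ 0) : (A * Aᵀ)⁻¹.PosDef := by
  refine Matrix.PosDef.inv ?_
  rw [← gram_rowVec]
  exact Matrix.posDef_gram_of_linearIndependent (linearIndependent_rowVec hA)

/-! ### Gaussian matrices: rotation invariance and full rank -/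

/-- The law of an `s × n` matrix with independent standard Gaussian entries. -/
noncomputable def gaussianMatrixLaw (s n : ℕ) : Measure (Fin s → Fin n → ℝ) :=
  Measure.pi fun _ => Measure.pi fun _ => gaussianReal 0 1

instance isProbabilityMeasure_gaussianMatrixLaw (s n : ℕ) :
    IsProbabilityMeasure (gaussianMatrixLaw s n) := by
  unfold gaussianMatrixLaw
  infer_instance

theorem map_curry_pi_gaussianReal (s n : ℕ) :
    (Measure.pi fun _ : Fin s × Fin n => gaussianReal 0 1).map Function.curry =
      gaussianMatrixLaw s n := by
  have h := Measure.infinitePi_map_curry (fun (_ : Fin s) (_ : Fin n) => gaussianReal 0 1)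
  simp only [Measure.infinitePi_eq_pi] at h
  exact h

theorem map_eq_gaussianMatrixLaw {Ω : Type*} [MeasurableSpace Ω] {P : Measure Ω}
    [IsProbabilityMeasure P] {s n : ℕ} {A : Ω → Matrix (Fin s) (Fin n) ℝ}
    (hA_law : ∀ i j, HasLaw (fun ω => A ω i j) (gaussianReal 0 1) P)
    (hA_indep : iIndepFun (fun (p : Fin s × Fin n) (ω : Ω) => A ω p.1 p.2) P) :
    P.map (fun (ω : Ω) (i : Fin s) (j : Fin n) => A ω i j) = gaussianMatrixLaw s n := by
  have hm : ∀ p : Fin s × Fin n, AEMeasurable (fun ω => A ω p.1 p.2) P :=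
    fun p => (hA_law p.1 p.2).aemeasurable
  have h := (iIndepFun_iff_map_fun_eq_pi_map hm).mp hA_indep
  simp only [fun p : Fin s × Fin n => (hA_law p.1 p.2).map_eq] at h
  rw [← map_curry_pi_gaussianReal, ← h, AEMeasurable.map_map_of_aemeasurable
    measurable_curry.aemeasurable (aemeasurable_pi_lambda _ hm)]
  rfl

/-- Left multiplication by an orthogonal matrix as an isometry of the space of matrices. -/
noncomputable def leftMulIso {s : ℕ} (n : ℕ) (M : Matrix (Fin s) (Fin s) ℝ) (hM : Mᵀ * M = 1) :
    EuclideanSpace ℝ (Fin s × Fin n) ≃ₗᵢ[ℝ] EuclideanSpace ℝ (Fin s × Fin n) where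
  toFun x := WithLp.toLp 2 fun p => (M * Matrix.of fun i j => x (i, j)) p.1 p.2
  invFun x := WithLp.toLp 2 fun p => (Mᵀ * Matrix.of fun i j => x (i, j)) p.1 p.2
  left_inv x := by
    ext p
    change (Mᵀ * (M * Matrix.of fun i j => x (i, j))) p.1 p.2 = x p
    rw [← Matrix.mul_assoc, hM, Matrix.one_mul, Matrix.of_apply]
  right_inv x := by
    ext p
    change (M * (Mᵀ * Matrix.of fun i j => x (i, j))) p.1 p.2 = x p
    rw [← Matrix.mul_assoc, mul_eq_one_comm.mp hM, Matrix.one_mul, Matrix.of_apply]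
  map_add' x y := by
    ext p
    simp [Matrix.mul_apply, mul_add, Finset.sum_add_distrib]
  map_smul' c x := by
    ext p
    simp [Matrix.mul_apply, Finset.mul_sum, mul_left_comm]
  norm_map' x := by
    rw [← sq_eq_sq₀ (norm_nonneg _) (norm_nonneg _), EuclideanSpace.real_norm_sq_eq,
      EuclideanSpace.real_norm_sq_eq, Fintype.sum_prod_type_right, Fintype.sum_prod_type_right]
    refine Finset.sum_congr rfl fun j _ => ?_
    have h := congrArg (· ^ 2) (norm_matAct hM (WithLp.toLp 2 fun i => x (i, j)))
    simp only [EuclideanSpace.real_norm_sq_eq] at h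
    exact h

theorem measurable_mul_of {s : ℕ} (n : ℕ) (M : Matrix (Fin s) (Fin s) ℝ) :
    Measurable fun (A : Fin s → Fin n → ℝ) i j => (M * Matrix.of A) i j := by
  simp only [Matrix.mul_apply, Matrix.of_apply]
  fun_prop

/-- The entries form a standard Gaussian vector of a Euclidean space, on which left multiplication
by `M` is an isometry. -/
theorem map_mul_gaussianMatrixLaw {s : ℕ} (n : ℕ) {M : Matrix (Fin s) (Fin s) ℝ}
    (hM : Mᵀ * M = 1) :
    (gaussianMatrixLaw s n).map (fun A i j => (M * Matrix.of A) i j) = gaussianMatrixLaw s n := by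
  have hc : Measurable fun x : EuclideanSpace ℝ (Fin s × Fin n) => Function.curry x.ofLp :=
    measurable_curry.comp (by fun_prop)
  have h1 : (stdGaussian (EuclideanSpace ℝ (Fin s × Fin n))).map
      (fun x => Function.curry x.ofLp) = gaussianMatrixLaw s n := by
    rw [← map_pi_eq_stdGaussian, Measure.map_map hc (by fun_prop), ← map_curry_pi_gaussianReal]
    rfl
  conv_lhs => rw [← h1]
  rw [Measure.map_map (measurable_mul_of n M) hc]
  conv_rhs => rw [← h1, ← stdGaussian_map (leftMulIso n M hM),
    Measure.map_map hc (leftMulIso n M hM).continuous.measurable]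
  rfl

theorem lintegral_mul_gaussianMatrixLaw {s n : ℕ} {M : Matrix (Fin s) (Fin s) ℝ}
    (hM : Mᵀ * M = 1) {g : (Fin s → Fin n → ℝ) → ENNReal} (hg : Measurable g) :
    ∫⁻ A, g (M * Matrix.of A) ∂gaussianMatrixLaw s n = ∫⁻ A, g A ∂gaussianMatrixLaw s n := by
  conv_rhs => rw [← map_mul_gaussianMatrixLaw n hM]
  exact (lintegral_map hg (measurable_mul_of n M)).symm

/-- A proper subspace lies in the kernel of a nonzero functional, whose law is a nondegenerate
Gaussian and has no atoms. -/
theorem stdGaussian_submodule_eq_zero {E : Type*} [NormedAddCommGroup E] [InnerProductSpace ℝ E]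
    [FiniteDimensional ℝ E] [MeasurableSpace E] [BorelSpace E] {W : Submodule ℝ E} (hW : W ≠ ⊤) :
    stdGaussian E W = 0 := by
  obtain ⟨f, hf, hWf⟩ := W.exists_le_ker_of_lt_top hW.lt_top
  let L : StrongDual ℝ E := f.toContinuousLinearMap
  have hL : ‖L‖ ^ 2 ≠ 0 := by
    refine pow_ne_zero 2 (norm_ne_zero_iff.mpr fun h => hf ?_)
    ext x
    exact congrArg (fun L' : StrongDual ℝ E => L' x) h
  have h1 : (stdGaussian E).map L {0} = 0 := by
    rw [IsGaussian.map_eq_gaussianReal, variance_dual_stdGaussian]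
    have := nullSingletonClass_gaussianReal (μ := (stdGaussian E)[L])
      (v := (‖L‖ ^ 2).toNNReal) (by simpa using hL)
    exact measure_singleton _
  rw [Measure.map_apply L.continuous.measurable (measurableSet_singleton _)] at h1
  exact measure_mono_null (fun x hx => hWf hx) h1

theorem continuous_det_mul_transpose (s n : ℕ) :
    Continuous fun A : Fin s → Fin n → ℝ => (Matrix.of A * (Matrix.of A)ᵀ).det := by
  have h : Continuous fun A : Fin s → Fin n → ℝ => (Matrix.of A : Matrix (Fin s) (Fin n) ℝ) :=
    continuous_id
  exact (h.matrix_mul h.matrix_transpose).matrix_det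

/-- Induction on the rows: `k < n` independent rows span a proper subspace, which a further
independent Gaussian row almost surely avoids. -/
theorem ae_det_mul_transpose_ne_zero {s n : ℕ} (hsn : s ≤ n) :
    ∀ᵐ A ∂gaussianMatrixLaw s n, (Matrix.of A * (Matrix.of A)ᵀ).det ≠ 0 := by
  induction s with
  | zero => simp
  | succ k ih =>
    have hmp := measurePreserving_piFinSuccAbove
      (fun _ : Fin (k + 1) => Measure.pi fun _ : Fin n => gaussianReal 0 1) 0
    have hS : MeasurableSet {q : (Fin n → ℝ) × (Fin k → Fin n → ℝ) |
        (Matrix.of (Fin.cons q.1 q.2 : Fin (k + 1) → Fin n → ℝ) *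
          (Matrix.of (Fin.cons q.1 q.2 : Fin (k + 1) → Fin n → ℝ))ᵀ).det ≠ 0} := by
      have hc : Continuous fun q : (Fin n → ℝ) × (Fin k → Fin n → ℝ) =>
          (Fin.cons q.1 q.2 : Fin (k + 1) → Fin n → ℝ) :=
        continuous_pi fun i => by
          refine Fin.cases ?_ (fun j => ?_) i
          · exact continuous_fst
          · exact (continuous_apply j).comp continuous_snd
      exact ((continuous_det_mul_transpose (k + 1) n).comp hc).measurable
        (measurableSet_singleton 0).compl
    have key : ∀ᵐ v ∂gaussianMatrixLaw k n, ∀ᵐ x ∂Measure.pi fun _ : Fin n => gaussianReal 0 1,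
        (Matrix.of (Fin.cons x v : Fin (k + 1) → Fin n → ℝ) *
          (Matrix.of (Fin.cons x v : Fin (k + 1) → Fin n → ℝ))ᵀ).det ≠ 0 := by
      filter_upwards [ih (by omega)] with v hv
      have hli := linearIndependent_rowVec hv
      have hW : Submodule.span ℝ (Set.range (rowVec (Matrix.of v))) ≠ ⊤ := by
        intro h
        have h1 := finrank_span_eq_card hli
        rw [h, finrank_top, finrank_euclideanSpace_fin, Fintype.card_fin] at h1
        omega
      have h0 := stdGaussian_submodule_eq_zero hW
      rw [← map_pi_eq_stdGaussian, Measure.map_apply (by fun_prop)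
        (Submodule.closed_of_finiteDimensional _).measurableSet] at h0
      have h2 : ∀ᵐ x ∂Measure.pi fun _ : Fin n => gaussianReal 0 1,
          WithLp.toLp 2 x ∉ Submodule.span ℝ (Set.range (rowVec (Matrix.of v))) := by
        rw [ae_iff]
        simpa using! h0
      filter_upwards [h2] with x hx
      have h3 := linearIndependent_finCons.mpr ⟨hli, hx⟩
      rw [← gram_rowVec]
      refine Matrix.det_gram_ne_zero_iff_linearIndependent.mpr ?_
      have h4 : rowVec (Matrix.of (Fin.cons x v : Fin (k + 1) → Fin n → ℝ)) =
          Fin.cons (WithLp.toLp 2 x) (rowVec (Matrix.of v)) :=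
        funext fun i => Fin.cases rfl (fun _ => rfl) i
      rw [h4]
      exact h3
    have h4 := (Measure.ae_prod_mem_iff_ae_ae_mem hS).mpr ((Measure.ae_ae_comm hS).mpr key)
    have h5 := hmp.quasiMeasurePreserving.ae h4
    unfold gaussianMatrixLaw
    filter_upwards [h5] with A hA
    have h6 : A = Fin.cons (A 0) fun i => A i.succ := (Fin.cons_self_tail A).symm
    rw [h6]
    exact hA

/-! ### Measurability in the matrix -/

theorem measurable_gramSchmidt_rowVec {s n : ℕ} (i : Fin s) :
    Measurable fun A : Fin s → Fin n → ℝ =>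
      InnerProductSpace.gramSchmidt ℝ (rowVec (Matrix.of A)) i := by
  induction i using WellFoundedLT.induction with
  | ind i ih =>
    have hr : Measurable fun A : Fin s → Fin n → ℝ => rowVec (Matrix.of A) i :=
      (PiLp.continuous_toLp 2 _).measurable.comp (measurable_pi_apply i)
    simp only [InnerProductSpace.gramSchmidt_def ℝ _ i, Submodule.starProjection_singleton]
    refine hr.sub (Finset.measurable_fun_sum _ fun j hj => ?_)
    have hj' := ih j (Finset.mem_Iio.mp hj)
    exact ((hj'.inner hr).div (hj'.norm.pow_const 2)).smul hj'

theorem measurable_gramSchmidtMatrix {s n : ℕ} (i : Fin s) (j : Fin n) :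
    Measurable fun A : Fin s → Fin n → ℝ => gramSchmidtMatrix (Matrix.of A) i j := by
  have h := measurable_gramSchmidt_rowVec (s := s) (n := n) i
  have h1 : Measurable fun A : Fin s → Fin n → ℝ =>
      InnerProductSpace.gramSchmidtNormed ℝ (rowVec (Matrix.of A)) i := by
    unfold InnerProductSpace.gramSchmidtNormed
    exact h.norm.inv.smul h
  exact (measurable_pi_apply j).comp ((PiLp.continuous_ofLp 2 _).measurable.comp h1)

theorem measurable_inv_mul_transpose {s n : ℕ} (i j : Fin s) :
    Measurable fun A : Fin s → Fin n → ℝ => (Matrix.of A * (Matrix.of A)ᵀ)⁻¹ i j := by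
  have h : Continuous fun A : Fin s → Fin n → ℝ => (Matrix.of A : Matrix (Fin s) (Fin n) ℝ) :=
    continuous_id
  have h1 := ((h.matrix_mul h.matrix_transpose).matrix_adjugate.matrix_elem i j).measurable
  simp only [Matrix.inv_def, Matrix.smul_apply, Ring.inverse_eq_inv', smul_eq_mul]
  exact (continuous_det_mul_transpose s n).measurable.inv.mul h1

theorem measurable_daggerMatrix {s n : ℕ} (i j : Fin s) :
    Measurable fun A : Fin s → Fin n → ℝ => daggerMatrix (Matrix.of A) i j := by
  have h1 := fun i j => measurable_inv_mul_transpose (s := s) (n := n) i j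
  have h2 := fun i j => measurable_gramSchmidtMatrix (s := s) (n := n) i j
  change Measurable fun A : Fin s → Fin n → ℝ => ∑ l, (∑ m, A m l *
    (Matrix.of A * (Matrix.of A)ᵀ)⁻¹ m i) * gramSchmidtMatrix (Matrix.of A) j l
  refine Finset.measurable_fun_sum _ fun l _ => Measurable.mul ?_ (h2 _ _)
  exact Finset.measurable_fun_sum _ fun l _ => Measurable.mul (by fun_prop) (h1 _ _)

theorem measurable_matAct {α : Type*} [MeasurableSpace α] {s : ℕ}
    {F : α → Matrix (Fin s) (Fin s) ℝ} (hF : ∀ i j, Measurable fun a => F a i j)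
    {x : α → EuclideanSpace ℝ (Fin s)} (hx : Measurable x) :
    Measurable fun a => matAct (F a) (x a) := by
  refine (PiLp.continuous_toLp 2 _).measurable.comp (measurable_pi_lambda _ fun i => ?_)
  change Measurable fun a => ∑ j, F a i j * x a j
  refine Finset.measurable_fun_sum _ fun j _ => (hF i j).mul ?_
  exact (measurable_pi_apply j).comp ((PiLp.continuous_ofLp 2 _).measurable.comp hx)

theorem measurable_sqrt_det (s n : ℕ) :
    Measurable fun A : Fin s → Fin n → ℝ => √(Matrix.of A * (Matrix.of A)ᵀ).det :=
  (continuous_det_mul_transpose s n).measurable.sqrt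

/-! ### Rotating the rows of the Gaussian matrix -/

theorem mul_mul_transpose_mul {s n : ℕ} (M : Matrix (Fin s) (Fin s) ℝ)
    (A : Matrix (Fin s) (Fin n) ℝ) : M * A * (M * A)ᵀ = M * (A * Aᵀ) * Mᵀ := by
  simp only [Matrix.transpose_mul, Matrix.mul_assoc]

theorem det_mul_mul_transpose_mul {s n : ℕ} {M : Matrix (Fin s) (Fin s) ℝ} (hM : Mᵀ * M = 1)
    (A : Matrix (Fin s) (Fin n) ℝ) : (M * A * (M * A)ᵀ).det = (A * Aᵀ).det := by
  rw [mul_mul_transpose_mul, Matrix.det_mul_comm, ← Matrix.mul_assoc, hM, Matrix.one_mul]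

theorem inv_mul_mul_transpose_mul {s n : ℕ} {M : Matrix (Fin s) (Fin s) ℝ} (hM : Mᵀ * M = 1)
    (A : Matrix (Fin s) (Fin n) ℝ) : (M * A * (M * A)ᵀ)⁻¹ = M * (A * Aᵀ)⁻¹ * Mᵀ := by
  rw [mul_mul_transpose_mul, Matrix.mul_inv_rev, Matrix.mul_inv_rev, Matrix.inv_eq_left_inv hM,
    Matrix.inv_eq_left_inv (mul_eq_one_comm.mp hM), Matrix.mul_assoc]

theorem lintegral_matAct_daggerMatrix {s n : ℕ} (hs : 1 ≤ s) (hsn : s ≤ n)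
    {M : Matrix (Fin s) (Fin s) ℝ} (hM : Mᵀ * M = 1)
    {f : ℝ × EuclideanSpace ℝ (Fin s) → ENNReal} (hf : Measurable f) :
    ∫⁻ A, ∫⁻ u, f (√(Matrix.of A * (Matrix.of A)ᵀ).det,
        matAct M (matAct (daggerMatrix (Matrix.of A)) u)) ∂sphereLaw s ∂gaussianMatrixLaw s n =
      ∫⁻ A, ∫⁻ u, f (√(Matrix.of A * (Matrix.of A)ᵀ).det,
        matAct (daggerMatrix (Matrix.of A)) u) ∂sphereLaw s ∂gaussianMatrixLaw s n := by
  have := isProbabilityMeasure_sphereLaw hs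
  have hm : Measurable fun A : Fin s → Fin n → ℝ =>
      ∫⁻ u, f (√(Matrix.of A * (Matrix.of A)ᵀ).det,
        matAct (daggerMatrix (Matrix.of A)) u) ∂sphereLaw s := by
    refine Measurable.lintegral_prod_right' (f := fun q : (Fin s → Fin n → ℝ) × _ =>
      f (√(Matrix.of q.1 * (Matrix.of q.1)ᵀ).det, matAct (daggerMatrix (Matrix.of q.1)) q.2)) ?_
    exact hf.comp (((measurable_sqrt_det s n).comp measurable_fst).prodMk
      (measurable_matAct (fun i j => (measurable_daggerMatrix i j).comp measurable_fst)
        measurable_snd))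
  rw [← lintegral_mul_gaussianMatrixLaw hM hm]
  refine lintegral_congr_ae ?_
  filter_upwards [ae_det_mul_transpose_ne_zero hsn] with A hA
  have hMA : ((M * Matrix.of A) * (M * Matrix.of A)ᵀ).det ≠ 0 := by
    rwa [det_mul_mul_transpose_mul hM]
  change _ = ∫⁻ u, f (√((M * Matrix.of A) * (M * Matrix.of A)ᵀ).det,
    matAct (daggerMatrix (M * Matrix.of A)) u) ∂sphereLaw s
  rw [det_mul_mul_transpose_mul hM]
  simp only [← matAct_mul]
  refine lintegral_matAct_sphereLaw_congr (det_daggerMatrix_ne_zero hMA) ?_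
    (g := fun x => f (√(Matrix.of A * (Matrix.of A)ᵀ).det, x)) (by fun_prop)
  rw [daggerMatrix_mul_transpose hMA, inv_mul_mul_transpose_mul hM,
    ← daggerMatrix_mul_transpose hA, Matrix.transpose_mul]
  simp only [Matrix.mul_assoc]

/-- In general `DᵀD` is not `(A Aᵀ)⁻¹`; only `D Dᵀ` is. Replacing `D` by the symmetric square root
`R` leaves the law unchanged and gives `‖R u‖² = ⟨u, R² u⟩`. -/
theorem lintegral_norm_matAct_daggerMatrix {s n : ℕ} {A : Matrix (Fin s) (Fin n) ℝ}
    (hA : (A * Aᵀ).det ≠ 0) {g : ℝ → ENNReal} (hg : Measurable g) :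
    ∫⁻ u, g ‖matAct (daggerMatrix A) u‖ ∂sphereLaw s =
      ∫⁻ u, g √(inner ℝ u (matAct (A * Aᵀ)⁻¹ u)) ∂sphereLaw s := by
  obtain ⟨R, hR1, hR2, hR3⟩ := exists_symmetric_mul_self_eq (posDef_inv_mul_transpose hA)
  rw [lintegral_matAct_sphereLaw_congr hR3 (by rw [daggerMatrix_mul_transpose hA, hR1, hR2])
    (g := fun x => g ‖x‖) (by fun_prop)]
  refine lintegral_congr fun u => ?_
  rw [← hR2, matAct_mul]
  nth_rw 2 [← hR1]
  rw [← inner_matAct, real_inner_self_eq_norm_sq, Real.sqrt_sq (norm_nonneg _)]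

theorem lintegral_inner_inv_eq {s n : ℕ} (i : Fin s) {u : EuclideanSpace ℝ (Fin s)}
    (hu : ‖u‖ = 1) {g : ℝ × ℝ → ENNReal} (hg : Measurable g) :
    ∫⁻ A, g (√(Matrix.of A * (Matrix.of A)ᵀ).det,
        √(inner ℝ u (matAct (Matrix.of A * (Matrix.of A)ᵀ)⁻¹ u))) ∂gaussianMatrixLaw s n =
      ∫⁻ A, g (√(Matrix.of A * (Matrix.of A)ᵀ).det,
        √((Matrix.of A * (Matrix.of A)ᵀ)⁻¹ i i)) ∂gaussianMatrixLaw s n := by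
  obtain ⟨M, hM, hMu⟩ := exists_orthogonal_matAct_eq (x := u)
    (y := EuclideanSpace.single i (1 : ℝ)) (by simp [hu])
  have hm : Measurable fun A : Fin s → Fin n → ℝ => g (√(Matrix.of A * (Matrix.of A)ᵀ).det,
      √((Matrix.of A * (Matrix.of A)ᵀ)⁻¹ i i)) :=
    hg.comp ((measurable_sqrt_det s n).prodMk (measurable_inv_mul_transpose i i).sqrt)
  rw [← lintegral_mul_gaussianMatrixLaw hM hm]
  refine lintegral_congr fun A => ?_
  change _ = g (√((M * Matrix.of A) * (M * Matrix.of A)ᵀ).det,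
    √(((M * Matrix.of A) * (M * Matrix.of A)ᵀ)⁻¹ i i))
  have h : ∀ B : Matrix (Fin s) (Fin s) ℝ,
      B i i = inner ℝ (EuclideanSpace.single i (1 : ℝ)) (matAct B (EuclideanSpace.single i 1)) := by
    intro B
    simp [EuclideanSpace.inner_single_left, matAct]
  rw [det_mul_mul_transpose_mul hM, h (M * Matrix.of A * (M * Matrix.of A)ᵀ)⁻¹,
    inv_mul_mul_transpose_mul hM, ← hMu, inner_matAct,
    ← matAct_mul, ← matAct_mul, ← Matrix.mul_assoc, ← Matrix.mul_assoc, hM, Matrix.one_mul,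
    Matrix.mul_assoc, hM, Matrix.mul_one]

theorem lintegral_daggerMatrix_eq {s n : ℕ} (hs : 1 ≤ s) (hsn : s ≤ n) (i : Fin s)
    {f : ℝ × EuclideanSpace ℝ (Fin s) → ENNReal} (hf : Measurable f) :
    ∫⁻ A, ∫⁻ u, f (√(Matrix.of A * (Matrix.of A)ᵀ).det,
        matAct (daggerMatrix (Matrix.of A)) u) ∂sphereLaw s ∂gaussianMatrixLaw s n =
      ∫⁻ A, ∫⁻ w, f (√(Matrix.of A * (Matrix.of A)ᵀ).det,
        √((Matrix.of A * (Matrix.of A)ᵀ)⁻¹ i i) • w) ∂sphereLaw s ∂gaussianMatrixLaw s n := by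
  have := isProbabilityMeasure_sphereLaw hs
  have hΦ : Measurable fun q : (Fin s → Fin n → ℝ) × EuclideanSpace ℝ (Fin s) =>
      (√(Matrix.of q.1 * (Matrix.of q.1)ᵀ).det, matAct (daggerMatrix (Matrix.of q.1)) q.2) :=
    ((measurable_sqrt_det s n).comp measurable_fst).prodMk
      (measurable_matAct (fun i j => (measurable_daggerMatrix i j).comp measurable_fst)
        measurable_snd)
  have hlaw : ∀ g : ℝ × EuclideanSpace ℝ (Fin s) → ENNReal, Measurable g →
      ∫⁻ p, g p ∂((gaussianMatrixLaw s n).prod (sphereLaw s)).map (fun q =>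
        (√(Matrix.of q.1 * (Matrix.of q.1)ᵀ).det, matAct (daggerMatrix (Matrix.of q.1)) q.2)) =
      ∫⁻ A, ∫⁻ u, g (√(Matrix.of A * (Matrix.of A)ᵀ).det,
        matAct (daggerMatrix (Matrix.of A)) u) ∂sphereLaw s ∂gaussianMatrixLaw s n := by
    intro g hg
    exact (lintegral_map hg hΦ).trans (lintegral_prod _ (hg.comp hΦ).aemeasurable)
  let g : ℝ × ℝ → ENNReal := fun p => ∫⁻ w, f (p.1, p.2 • w) ∂sphereLaw s
  have hg : Measurable g := by
    refine Measurable.lintegral_prod_right' (f := fun q : (ℝ × ℝ) × EuclideanSpace ℝ (Fin s) =>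
      f (q.1.1, q.1.2 • q.2)) ?_
    fun_prop
  rw [← hlaw f hf, lintegral_eq_lintegral_norm_smul _ hs _ hf]
  · have hgn : Measurable fun p : ℝ × EuclideanSpace ℝ (Fin s) => g (p.1, ‖p.2‖) := by fun_prop
    rw [show (∫⁻ p, ∫⁻ w, f (p.1, ‖p.2‖ • w) ∂sphereLaw s ∂_) = _ from hlaw _ hgn]
    have h1 : ∀ᵐ A ∂gaussianMatrixLaw s n,
        ∫⁻ u, g (√(Matrix.of A * (Matrix.of A)ᵀ).det, ‖matAct (daggerMatrix (Matrix.of A)) u‖)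
          ∂sphereLaw s =
        ∫⁻ u, g (√(Matrix.of A * (Matrix.of A)ᵀ).det,
          √(inner ℝ u (matAct (Matrix.of A * (Matrix.of A)ᵀ)⁻¹ u))) ∂sphereLaw s := by
      filter_upwards [ae_det_mul_transpose_ne_zero hsn] with A hA
      exact lintegral_norm_matAct_daggerMatrix hA
        (g := fun r => g (√(Matrix.of A * (Matrix.of A)ᵀ).det, r)) (by fun_prop)
    -- Integrating over `A` first makes `u` a fixed unit vector, which a rotation of `A` can move to
    -- the basis vector `i`.
    rw [lintegral_congr_ae h1, lintegral_lintegral_swap]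
    · have h2 : ∀ᵐ u ∂sphereLaw s,
          ∫⁻ A, g (√(Matrix.of A * (Matrix.of A)ᵀ).det,
            √(inner ℝ u (matAct (Matrix.of A * (Matrix.of A)ᵀ)⁻¹ u))) ∂gaussianMatrixLaw s n =
          ∫⁻ A, g (√(Matrix.of A * (Matrix.of A)ᵀ).det,
            √((Matrix.of A * (Matrix.of A)ᵀ)⁻¹ i i)) ∂gaussianMatrixLaw s n := by
        filter_upwards [ae_norm_eq_one_sphereLaw s] with u hu
        exact lintegral_inner_inv_eq i hu hg
      rw [lintegral_congr_ae h2]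
      simp [g]
    · refine (hg.comp (((measurable_sqrt_det s n).comp measurable_fst).prodMk
        (Measurable.sqrt (measurable_snd.inner (measurable_matAct (fun i j =>
          (measurable_inv_mul_transpose i j).comp measurable_fst)
            measurable_snd))))).aemeasurable
  · intro M hM f' hf'
    have h3 : Measurable fun p : ℝ × EuclideanSpace ℝ (Fin s) => f' (p.1, matAct M p.2) :=
      hf'.comp (measurable_fst.prodMk ((continuous_matAct M).measurable.comp measurable_snd))
    rw [hlaw f' hf', hlaw _ h3]
    exact lintegral_matAct_daggerMatrix hs hsn hM hf'

/-! ### From laws to the random variables -/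

theorem map_prodMk_eq_prod {Ω : Type*} [MeasurableSpace Ω] {P : Measure Ω}
    [IsProbabilityMeasure P] {s n : ℕ} {A : Ω → Matrix (Fin s) (Fin n) ℝ}
    (hA_law : ∀ i j, HasLaw (fun ω => A ω i j) (gaussianReal 0 1) P)
    (hA_indep : iIndepFun (fun (p : Fin s × Fin n) (ω : Ω) => A ω p.1 p.2) P)
    {u : Ω → Metric.sphere (0 : EuclideanSpace ℝ (Fin s)) 1}
    (hu_law : HasLaw u (uniformSphere s) P)
    (hu_indep : IndepFun u (fun (ω : Ω) (i : Fin s) (j : Fin n) => A ω i j) P) :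
    HasLaw (fun ω => ((fun i j => A ω i j : Fin s → Fin n → ℝ),
      (u ω : EuclideanSpace ℝ (Fin s)))) ((gaussianMatrixLaw s n).prod (sphereLaw s)) P := by
  have hA : AEMeasurable (fun (ω : Ω) (i : Fin s) (j : Fin n) => A ω i j) P :=
    aemeasurable_pi_lambda _ fun i => aemeasurable_pi_lambda _ fun j => (hA_law i j).aemeasurable
  have hu : AEMeasurable (fun ω => (u ω : EuclideanSpace ℝ (Fin s))) P :=
    measurable_subtype_coe.comp_aemeasurable hu_law.aemeasurable
  refine ⟨hA.prodMk hu, ?_⟩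
  have h := (hu_indep.comp measurable_subtype_coe measurable_id).symm
  rw [(indepFun_iff_map_prod_eq_prod_map_map hA hu).mp h,
    map_eq_gaussianMatrixLaw hA_law hA_indep, sphereLaw, ← hu_law.map_eq,
    AEMeasurable.map_map_of_aemeasurable measurable_subtype_coe.aemeasurable hu_law.aemeasurable]
  rfl

theorem identDistrib_comp_of_map_eq {Ω α β : Type*} [MeasurableSpace Ω] [MeasurableSpace α]
    [MeasurableSpace β] {P : Measure Ω} {μ : Measure α} {X Y : Ω → α} (hX : HasLaw X μ P)
    (hY : HasLaw Y μ P) {f g : α → β} (hf : Measurable f) (hg : Measurable g)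
    (h : μ.map f = μ.map g) : IdentDistrib (fun ω => f (X ω)) (fun ω => g (Y ω)) P P := by
  refine ⟨hf.comp_aemeasurable hX.aemeasurable, hg.comp_aemeasurable hY.aemeasurable, ?_⟩
  have h2 := AEMeasurable.map_map_of_aemeasurable hf.aemeasurable hX.aemeasurable
  have h3 := AEMeasurable.map_map_of_aemeasurable hg.aemeasurable hY.aemeasurable
  rw [hX.map_eq] at h2
  rw [hY.map_eq] at h3
  exact h2.symm.trans (h.trans h3)

theorem mainTheorem5 {Ω : Type*} [MeasurableSpace Ω] (P : Measure Ω) [IsProbabilityMeasure P]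
    (s n : ℕ) (hs : 1 ≤ s) (hsn : s ≤ n)
    (A : Ω → Matrix (Fin s) (Fin n) ℝ)
    (hA_law : ∀ i j, HasLaw (fun ω => A ω i j) (gaussianReal 0 1) P)
    (hA_indep : iIndepFun (fun (p : Fin s × Fin n) (ω : Ω) => A ω p.1 p.2) P)
    (u w : Ω → Metric.sphere (0 : EuclideanSpace ℝ (Fin s)) 1)
    (hu_law : HasLaw u (uniformSphere s) P)
    (hu_indep : IndepFun u (fun (ω : Ω) (i : Fin s) (j : Fin n) => A ω i j) P)
    (hw_law : HasLaw w (uniformSphere s) P)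
    (hw_indep : IndepFun w (fun (ω : Ω) (i : Fin s) (j : Fin n) => A ω i j) P) :
    IdentDistrib
      (fun ω => (Real.sqrt (A ω * (A ω)ᵀ).det,
        daggerQ (A ω) (u ω : EuclideanSpace ℝ (Fin s))))
      (fun ω => (rowVol (A ω) (s - 1) (Nat.sub_le s 1) *
          ‖rowPerp (A ω) ⟨s - 1, Nat.sub_lt hs Nat.one_pos⟩‖,
        (1 / ‖rowPerp (A ω) ⟨s - 1, Nat.sub_lt hs Nat.one_pos⟩‖) •
          (w ω : EuclideanSpace ℝ (Fin s))))
      P P := by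
  obtain ⟨k, rfl⟩ : ∃ k, s = k + 1 := ⟨s - 1, by omega⟩
  have := isProbabilityMeasure_sphereLaw hs
  have hΦ : Measurable fun q : (Fin (k + 1) → Fin n → ℝ) × EuclideanSpace ℝ (Fin (k + 1)) =>
      (√(Matrix.of q.1 * (Matrix.of q.1)ᵀ).det, matAct (daggerMatrix (Matrix.of q.1)) q.2) :=
    ((measurable_sqrt_det _ n).comp measurable_fst).prodMk
      (measurable_matAct (fun i j => (measurable_daggerMatrix i j).comp measurable_fst)
        measurable_snd)
  have hΨ : Measurable fun q : (Fin (k + 1) → Fin n → ℝ) × EuclideanSpace ℝ (Fin (k + 1)) =>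
      (√(Matrix.of q.1 * (Matrix.of q.1)ᵀ).det,
        √((Matrix.of q.1 * (Matrix.of q.1)ᵀ)⁻¹ (Fin.last k) (Fin.last k)) • q.2) :=
    ((measurable_sqrt_det _ n).comp measurable_fst).prodMk
      (((measurable_inv_mul_transpose _ _).comp measurable_fst).sqrt.smul measurable_snd)
  have hmap : ((gaussianMatrixLaw (k + 1) n).prod (sphereLaw (k + 1))).map (fun q =>
      (√(Matrix.of q.1 * (Matrix.of q.1)ᵀ).det, matAct (daggerMatrix (Matrix.of q.1)) q.2)) =
      ((gaussianMatrixLaw (k + 1) n).prod (sphereLaw (k + 1))).map (fun q =>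
      (√(Matrix.of q.1 * (Matrix.of q.1)ᵀ).det,
        √((Matrix.of q.1 * (Matrix.of q.1)ᵀ)⁻¹ (Fin.last k) (Fin.last k)) • q.2)) := by
    refine Measure.ext_of_lintegral _ fun f hf => ?_
    rw [lintegral_map hf hΦ, lintegral_map hf hΨ]
    exact (lintegral_prod _ (hf.comp hΦ).aemeasurable).trans
      ((lintegral_daggerMatrix_eq hs hsn (Fin.last k) hf).trans
        (lintegral_prod _ (hf.comp hΨ).aemeasurable).symm)
  -- `(A, u)` and `(A, w)` have the same product law, so the joint behaviour of `u` and `w` plays no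
  -- role.
  have hu := map_prodMk_eq_prod hA_law hA_indep hu_law hu_indep
  have hw := map_prodMk_eq_prod hA_law hA_indep hw_law hw_indep
  have hAm := map_eq_gaussianMatrixLaw hA_law hA_indep
  have hrank : ∀ᵐ ω ∂P, (A ω * (A ω)ᵀ).det ≠ 0 := by
    have h := ae_det_mul_transpose_ne_zero hsn
    rw [← hAm] at h
    exact ae_of_ae_map (aemeasurable_pi_lambda _ fun i => aemeasurable_pi_lambda _ fun j =>
      (hA_law i j).aemeasurable) h
  have h1 : IdentDistrib
      (fun ω => (√(A ω * (A ω)ᵀ).det, matAct (daggerMatrix (A ω)) (u ω)))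
      (fun ω => (√(A ω * (A ω)ᵀ).det,
        √((A ω * (A ω)ᵀ)⁻¹ (Fin.last k) (Fin.last k)) • (w ω : EuclideanSpace ℝ (Fin (k + 1)))))
      P P := by
    exact identDistrib_comp_of_map_eq hu hw hΦ hΨ hmap
  -- The row identities need full rank, so the two pairs agree only almost surely.
  have h4 : (fun ω => (√(A ω * (A ω)ᵀ).det,
      √((A ω * (A ω)ᵀ)⁻¹ (Fin.last k) (Fin.last k)) • (w ω : EuclideanSpace ℝ (Fin (k + 1))))) =ᵐ[P]
      fun ω => (rowVol (A ω) k (Nat.le_succ k) * ‖rowPerp (A ω) (Fin.last k)‖,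
        (1 / ‖rowPerp (A ω) (Fin.last k)‖) • (w ω : EuclideanSpace ℝ (Fin (k + 1)))) := by
    filter_upwards [hrank] with ω hω
    rw [sqrt_inv_eq_inv_norm_rowPerp hω, sqrt_det_eq_rowVol_mul_norm_rowPerp hω]
  simp only [daggerQ_eq_matAct]
  exact h1.trans (IdentDistrib.of_ae_eq h1.aemeasurable_snd h4)
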